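/- Let $\mathcal X\subseteq\mathbb R^n$ be a Borel set, $\mathcal U\subseteq\mathbb R^m$ compact, $\mathcal W\subseteq\mathbb R^n$ with $0\in\mathcal W$, and $f:\mathcal X\times\mathcal U\to\mathcal X$ Borel measurable. Consider the system $$x_{k+1}=f(x_k,u_k)+w_k,\qquad x_k\in\mathcal X,\ u_k\in\mathcal U,\ w_k\in\mathcal W,$$ where $f(x,u)+w\in\mathcal X$ for all $x\in\mathcal X$, $u\in\mathcal U$, $w\in\mathcal W$. Let $N\in\mathbb N=\{0,1,2,\dots\}$, and let $w_0,\dots,w_{N-1}$ be i.i.d. with a law $\mathbb P_w$ on $\mathcal W$ that is absolutely continuous, with a density $\psi_w$ on $\mathbb R^n$ that is continuous on $\mathcal W$. Let $\mathcal K,\mathcal T\subseteq\mathcal X$ be closed in $\mathcal X$. For $t\in\mathbb N$ and $\overline{\mathcal W}\subseteq\mathcal W$, the $t$-time robust reach-avoid set $\mathrm{RA}_t(\mathcal T,\mathcal K,\overline{\mathcal W})$ is the set of $x_0\in\mathcal X$ for which there are (arbitrary) feedback laws $\nu_0,\dots,\nu_{t-1}:\mathcal X\to\mathcal U$ such that for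 all $(w_0,\dots,w_{t-1})\in\overline{\mathcal W}^{\,t}$ the states $x_{k+1}=f(x_k,\nu_k(x_k))+w_k$ satisfy $x_k\in\mathcal K$ for $0\le k\le t-1$ and $x_t\in\mathcal T$. For $0\le k\le N$ and $x\in\mathcal X$, the optimal value function is $$V_k^*(x)=\sup_{\mu_k,\dots,\mu_{N-1}}\mathbb E\Big[\Big(\prod_{i=k}^{N-1}\mathbf 1_{\mathcal K}(x_i)\Big)\mathbf 1_{\mathcal T}(x_N)\Big],$$ where the supremum is over universally measurable feedback laws $\mu_i:\mathcal X\to\mathcal U$, and $x_k=x$, $x_{i+1}=f(x_i,\mu_i(x_i))+w_i$ for $k\le i\le N-1$ (so $V_N^*=\mathbf 1_{\mathcal T}$). For $\beta\in[0,1]$ and $0\le t\le N$, the stochastic reach-avoid $\beta$-level-set is $\mathcal L_t(\beta)=\{x\in\mathcal X: V_{N-t}^*(x)\ge\beta\}$. **Theorem.** Let $\beta\in[0,1]$ and $0\le t\le N$, and let $\overline{\mathcal W}\subseteq\mathcal W$ be a measurable set such that, if $t\ge1$, $\mathbb P_w(w_k\in\overline{\mathcal W})=\beta^{1/t}$ for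 all $0\le k\le t-1$. Then $$\mathrm{RA}_t(\mathcal T,\mathcal K,\overline{\mathcal W})\subseteq\mathcal L_t(\beta).$$ -/

import Mathlib

open MeasureTheory

noncomputable section

namespace ReachAvoid

/-- A discrete-time, time-invariant system `x⁺ = f(x, u) + w` with state space `X ⊆ ℝⁿ`,
input space `U ⊆ ℝᵐ`, disturbance space `W ⊆ ℝⁿ` containing `0`, and `f : X × U → X`.
The last field says that the successor state is again a state. -/
structure System (n m : ℕ) where
  X : Set (EuclideanSpace ℝ (Fin n))
  U : Set (EuclideanSpace ℝ (Fin m))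
  W : Set (EuclideanSpace ℝ (Fin n))
  f : X → U → X
  zero_mem : 0 ∈ W
  add_mem : ∀ (x : X) (u : U) (w : W),
    (f x u : EuclideanSpace ℝ (Fin n)) + (w : EuclideanSpace ℝ (Fin n)) ∈ X

namespace System

variable {n m : ℕ} (S : System n m)

/-- The successor state `f(x, u) + w`. -/
def next (x : S.X) (u : S.U) (w : S.W) : S.X :=
  ⟨(S.f x u : EuclideanSpace ℝ (Fin n)) + (w : EuclideanSpace ℝ (Fin n)), S.add_mem x u w⟩

/-- The states `x₀, …, x_t` generated from `x₀` by the feedback laws `ν₀, …, ν_{t-1}` and the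
disturbances `w₀, …, w_{t-1}`. -/
def traj {t : ℕ} (ν : Fin t → S.X → S.U) (w : Fin t → S.W) (x₀ : S.X) (k : Fin (t + 1)) : S.X :=
  Fin.induction (motive := fun _ => S.X) x₀ (fun i x => S.next x (ν i x) (w i)) k

/-- The `t`-time robust reach-avoid set: the initial states from which some policy made of
arbitrary feedback laws keeps `x₀, …, x_{t-1}` in `K` and brings `x_t` into `T`, whatever the
disturbances in `Wbar` are. -/
def robustReachAvoid (t : ℕ) (T K : Set S.X) (Wbar : Set S.W) : Set S.X :=
  {x₀ | ∃ ν : Fin t → S.X → S.U, ∀ w : Fin t → S.W, (∀ k, w k ∈ Wbar) →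
    (∀ k : Fin t, S.traj ν w x₀ k.castSucc ∈ K) ∧ S.traj ν w x₀ (Fin.last t) ∈ T}

end System

/-- Universal measurability: preimages of measurable sets are measurable for the completion of
every finite measure. -/
def UniversallyMeasurable {α β : Type*} [MeasurableSpace α] [MeasurableSpace β]
    (g : α → β) : Prop :=
  ∀ ρ : Measure α, IsFiniteMeasure ρ → NullMeasurable g ρ

namespace System

variable {n m : ℕ} (S : System n m)

/-- Markov policies over `t` stages: `t` universally measurable state-feedback laws. -/
def MarkovPolicy (t : ℕ) : Type :=
  {μ : Fin t → S.X → S.U // ∀ k, UniversallyMeasurable (μ k)}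

/-- The expectation of `(∏_{k<t} 1_K(x_k)) 1_T(x_t)` under the Markov policy `π` started at `x`,
where `w₀, …, w_{t-1}` are i.i.d. with law `Pw`; this is the probability of achieving the
reach-avoid objective. -/
def reachAvoidProb (Pw : Measure S.W) (T K : Set S.X) {t : ℕ} (π : S.MarkovPolicy t)
    (x : S.X) : ENNReal :=
  ∫⁻ w : Fin t → S.W,
    (∏ k : Fin t, K.indicator (fun _ => (1 : ENNReal)) (S.traj π.1 w x k.castSucc)) *
      T.indicator (fun _ => (1 : ENNReal)) (S.traj π.1 w x (Fin.last t))
    ∂(Measure.pi fun _ : Fin t => Pw)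

/-- The optimal value function `V*_k` for the horizon `N`: the largest probability, over Markov
policies, of achieving the reach-avoid objective during the `N - k` stages that remain when the
state at time `k` is `x`. -/
def optimalValue (Pw : Measure S.W) (T K : Set S.X) (N k : ℕ) (x : S.X) : ENNReal :=
  ⨆ π : S.MarkovPolicy (N - k), S.reachAvoidProb Pw T K π x

/-- The stochastic reach-avoid `β`-level-set `L_t(β) = {x | V*_{N-t}(x) ≥ β}`. -/
def levelSet (Pw : Measure S.W) (T K : Set S.X) (N t : ℕ) (β : ℝ) : Set S.X :=
  {x | ENNReal.ofReal β ≤ S.optimalValue Pw T K N (N - t) x}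

end System

end ReachAvoid

end

/-!
The robust feedback laws are arbitrary functions, while the value function only sees universally
measurable ones, so the point is to replace the former by the latter without losing probability.

Let `p` be the probability of `Wbar`. By backward induction there is, for each horizon `t`, a Borel
policy that succeeds with probability at least `p ^ t` from Lebesgue-almost every state of the
`t`-time robust reach-avoid set (`exists_measurable_policy_ae`). In the induction step, a state `x`
of the robust set for `t + 1` stages has an input `u` that leads into the robust set for `t` stages
for all disturbances in `Wbar`. The disturbance has a density, so the null set of bad states of the
Borel policy for `t` stages is almost surely missed (`ae_next`), and following that policy after
`u` succeeds with probability at least `p * p ^ t` (`exists_le_lintegral_next`). The pairs `(x, u)`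
with the latter property form a Borel set, and measurable selection yields a Borel law that picks
such a `u` for almost every `x` (`MeasurableSet.exists_measurable_selection`). At the given initial
state itself no selection is needed, since the first law may be constant; this removes the
exceptional null set (`exists_measurable_policy`).

Measurable selection up to null sets is proved through capacitability: the projection of a Borel
set is a continuous image of Baire space, whose outer measure is exhausted by images of compact
boxes (`exists_le_measure_image_forall_le`). After embedding the inputs into `ℝ`, a compact set has
the least point of each section as a Borel selector (`IsCompact.exists_measurable_section`).
-/

/-! ### Measurable selection up to null sets -/

open Set Filter Topology in
/-- The sets `{a | ∀ i < k, a i ≤ b i}` shrink to the compact box `{a | ∀ i, a i ≤ b i}` of Baire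
space in the strong sense that every open set around the box contains one of them. -/
theorem exists_forall_lt_le_subset_of_isOpen {b : ℕ → ℕ} {V : Set (ℕ → ℕ)} (hV : IsOpen V)
    (hb : {a : ℕ → ℕ | ∀ i, a i ≤ b i} ⊆ V) : ∃ k, {a : ℕ → ℕ | ∀ i < k, a i ≤ b i} ⊆ V := by
  by_contra! h
  have h' : ∀ k, ∃ a : ℕ → ℕ, (∀ i < k, a i ≤ b i) ∧ a ∉ V := fun k => by
    simpa [Set.not_subset] using h k
  choose a ha haV using h'
  have hcomp : IsCompact {a : ℕ → ℕ | ∀ i, a i ∈ Set.Iic (b i)} :=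
    isCompact_pi_infinite fun i => (Set.finite_Iic (b i)).isCompact
  obtain ⟨a₀, ha₀, φ, hφ, hlim⟩ := hcomp.tendsto_subseq
    (x := fun k i => min (a k i) (b i)) fun k i => Set.mem_Iic.2 (min_le_right _ _)
  -- The truncations `min (a k) b` agree with `a k` below `k`, so both have the same limit.
  have hlim' : Tendsto (a ∘ φ) atTop (𝓝 a₀) := by
    rw [tendsto_pi_nhds] at hlim ⊢
    intro i
    refine (hlim i).congr' ?_
    filter_upwards [eventually_gt_atTop i] with k hk
    exact min_eq_left (ha _ _ (hk.trans_le (hφ.id_le k)))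
  obtain ⟨k, hk⟩ := (hlim'.eventually (hV.mem_nhds (hb ha₀))).exists
  exact haV _ hk

open Set in
/-- Capacitability of analytic sets: the outer measure of a continuous image of Baire space is
approximated from inside by the images of compact boxes. -/
theorem exists_le_measure_image_forall_le {X : Type*} [TopologicalSpace X] [MeasurableSpace X]
    (ρ : Measure X) [ρ.OuterRegular] {g : (ℕ → ℕ) → X} (hg : Continuous g) {c : ENNReal}
    (hc : c < ρ (range g)) : ∃ b : ℕ → ℕ, c ≤ ρ (g '' {a | ∀ i, a i ≤ b i}) := by
  have step : ∀ (k : ℕ) (s : {s : Set (ℕ → ℕ) // c < ρ (g '' s)}),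
      ∃ N : ℕ, c < ρ (g '' (s.1 ∩ {a | a k ≤ N})) := by
    rintro k ⟨s, hs⟩
    have hU : g '' s = ⋃ N : ℕ, g '' (s ∩ {a | a k ≤ N}) := by
      rw [← image_iUnion, ← inter_iUnion]
      congr 1
      refine (inter_eq_left.2 fun a _ => ?_).symm
      exact mem_iUnion.2 ⟨a k, le_refl (a k)⟩
    have hmono : Monotone fun N : ℕ => g '' (s ∩ {a | a k ≤ N}) := fun M N hMN =>
      image_mono (inter_subset_inter_right _ fun a (ha : a k ≤ M) => ha.trans hMN)
    rw [hU, hmono.measure_iUnion] at hs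
    exact lt_iSup_iff.1 hs
  choose N hN using step
  -- Cut down one coordinate at a time, keeping the outer measure of the image above `c`.
  let s : ℕ → {s : Set (ℕ → ℕ) // c < ρ (g '' s)} := fun k =>
    Nat.rec ⟨univ, by rwa [image_univ]⟩ (fun k s => ⟨s.1 ∩ {a | a k ≤ N k s}, hN k s⟩) k
  have hs : ∀ k, (s k).1 = {a | ∀ i < k, a i ≤ N i (s i)} := by
    intro k
    induction k with
    | zero => ext a; simp [s]
    | succ k ih =>
      have : (s (k + 1)).1 = (s k).1 ∩ {a | a k ≤ N k (s k)} := rfl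
      rw [this, ih]
      ext a
      simp only [mem_inter_iff, mem_ofPred_eq, Nat.lt_succ_iff_lt_or_eq]
      exact ⟨fun h i hi => hi.elim (h.1 i) fun e => e ▸ h.2,
        fun h => ⟨fun i hi => h i (.inl hi), h k (.inr rfl)⟩⟩
  refine ⟨fun i => N i (s i), ?_⟩
  rw [measure_eq_iInf_isOpen]
  refine le_iInf₂ fun V hV => le_iInf fun hVo => ?_
  obtain ⟨k, hk⟩ := exists_forall_lt_le_subset_of_isOpen (hVo.preimage hg) (image_subset_iff.1 hV)
  refine (s k).2.le.trans (measure_mono ?_)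
  rw [hs k]
  exact image_subset_iff.2 hk

open Set in
/-- The least element of each section is a Borel selector of a compact subset of `X × ℝ`. -/
theorem IsCompact.exists_measurable_section {X : Type*} [TopologicalSpace X] [T2Space X]
    [MeasurableSpace X] [BorelSpace X] {C : Set (X × ℝ)} (hC : IsCompact C) :
    ∃ m : X → ℝ, Measurable m ∧ ∀ x ∈ Prod.fst '' C, (x, m x) ∈ C := by
  have hmem : ∀ x ∈ Prod.fst '' C, (x, sInf {r | (x, r) ∈ C}) ∈ C := by
    rintro x ⟨⟨x, r⟩, hr, rfl⟩
    have hcomp : IsCompact {r | (x, r) ∈ C} := by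
      have : {r | (x, r) ∈ C} = Prod.snd '' (C ∩ Prod.fst ⁻¹' {x}) := by
        ext r
        constructor
        · exact fun h => ⟨(x, r), ⟨h, rfl⟩, rfl⟩
        · rintro ⟨⟨y, r⟩, ⟨h, rfl⟩, rfl⟩
          exact h
      rw [this]
      exact (hC.inter_right (isClosed_singleton.preimage continuous_fst)).image continuous_snd
    exact hcomp.sInf_mem ⟨r, hr⟩
  refine ⟨fun x => sInf {r | (x, r) ∈ C}, measurable_of_Iic fun c => ?_, hmem⟩
  have hD : MeasurableSet (Prod.fst '' C) := (hC.image continuous_fst).isClosed.measurableSet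
  have hE : MeasurableSet (Prod.fst '' (C ∩ Prod.snd ⁻¹' Iic c)) :=
    ((hC.inter_right (isClosed_Iic.preimage continuous_snd)).image
      continuous_fst).isClosed.measurableSet
  -- Away from the projection of `C` the infimum is `sInf ∅ = 0`.
  have : (fun x => sInf {r | (x, r) ∈ C}) ⁻¹' Iic c =
      Prod.fst '' (C ∩ Prod.snd ⁻¹' Iic c) ∪ ((Prod.fst '' C)ᶜ ∩ {_x | (0 : ℝ) ≤ c}) := by
    ext x
    by_cases hx : x ∈ Prod.fst '' C
    · constructor
      · exact fun h => .inl ⟨_, ⟨hmem x hx, h⟩, rfl⟩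
      · rintro (⟨⟨y, r⟩, ⟨hr, hrc⟩, rfl⟩ | h)
        · obtain ⟨b, hb⟩ := (hC.image continuous_snd).bddBelow
          exact (csInf_le ⟨b, fun q hq => hb ⟨_, hq, rfl⟩⟩ hr).trans hrc
        · exact absurd hx h.1
    · have he : {r | (x, r) ∈ C} = ∅ :=
        eq_empty_of_forall_notMem fun r hr => hx ⟨_, hr, rfl⟩
      have hx' : x ∉ Prod.fst '' (C ∩ Prod.snd ⁻¹' Iic c) :=
        fun h => hx (image_mono inter_subset_left h)
      simp only [mem_preimage, he, Real.sInf_empty, mem_Iic, mem_union, hx', false_or,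
        mem_inter_iff, mem_compl_iff, hx, not_false_eq_true, true_and, mem_ofPred_eq]
  rw [this]
  exact hE.union (hD.compl.inter (MeasurableSet.const _))

open Set in
/-- Measurable selection: up to a null set, a Borel set `B ⊆ X × U` has a Borel selector on its
whole projection, although the projection itself need not be Borel. -/
theorem MeasurableSet.exists_measurable_selection {X U : Type*} [MeasurableSpace X]
    [StandardBorelSpace X] [MeasurableSpace U] [StandardBorelSpace U] [Nonempty U]
    (ρ : Measure X) [IsFiniteMeasure ρ] {B : Set (X × U)} (hB : MeasurableSet B) :
    ∃ μ : X → U, Measurable μ ∧ ∀ᵐ x ∂ρ, (∃ u, (x, u) ∈ B) → (x, μ x) ∈ B := by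
  let := upgradeStandardBorel X
  have he : MeasurableEmbedding (embeddingReal U) := measurableEmbedding_embeddingReal U
  set e := embeddingReal U
  set A : Set X := Prod.fst '' B with hA
  by_cases hA0 : ρ A = 0
  · refine ⟨fun _ => Classical.arbitrary U, measurable_const, ?_⟩
    filter_upwards [measure_eq_zero_iff_ae_notMem.1 hA0] with x hx ⟨u, hu⟩
    exact absurd ⟨_, hu, rfl⟩ hx
  have hB' : AnalyticSet (Prod.map id e '' B) :=
    ((MeasurableEmbedding.id.prodMap he).measurableSet_image.2 hB).analyticSet
  rw [AnalyticSet] at hB'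
  obtain h | ⟨φ, hφ, hrange⟩ := hB'
  · rw [image_eq_empty] at h
    simp [hA, h] at hA0
  have hfst : range (Prod.fst ∘ φ) = A := by
    rw [range_comp, hrange, image_image]
    rfl
  have hex : ∀ k : ℕ, ∃ (D : Set X) (s : X → U), MeasurableSet D ∧ Measurable s ∧
      ρ A - (k + 1 : ENNReal)⁻¹ ≤ ρ D ∧ ∀ x ∈ D, (x, s x) ∈ B := by
    intro k
    have hlt : ρ A - (k + 1 : ENNReal)⁻¹ < ρ (range (Prod.fst ∘ φ)) := by
      rw [hfst]
      exact ENNReal.sub_lt_self (measure_ne_top _ _) hA0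
        (ENNReal.inv_ne_zero.2 (by finiteness))
    obtain ⟨b, hb⟩ := exists_le_measure_image_forall_le ρ (continuous_fst.comp hφ) hlt
    have hcomp : IsCompact (φ '' {a | ∀ i, a i ≤ b i}) :=
      (isCompact_pi_infinite fun i => (finite_Iic (b i)).isCompact).image hφ
    obtain ⟨m, hm, hmC⟩ := hcomp.exists_measurable_section
    refine ⟨Prod.fst '' (φ '' {a | ∀ i, a i ≤ b i}), he.invFun ∘ m,
      (hcomp.image continuous_fst).isClosed.measurableSet, he.measurable_invFun.comp hm,
      by rwa [← image_comp], fun x hx => ?_⟩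
    have : (x, m x) ∈ Prod.map id e '' B := hrange ▸ image_subset_range _ _ (hmC x hx)
    obtain ⟨⟨y, u⟩, hu, hxu⟩ := this
    obtain ⟨rfl, hmu⟩ := Prod.mk.inj hxu
    have hu' : he.invFun (m (id y)) = u := by rw [← hmu, he.leftInverse_invFun]
    rw [Function.comp_apply, hu']
    exact hu
  choose D s hD hs hρ hDs using hex
  -- The measurable sets `D k` exhaust the outer measure of the projection, hence fill it up to a
  -- null set; each point uses the selector of the first `D k` that contains it.
  have hDA : ⋃ k, D k ⊆ A := iUnion_subset fun k x hx => ⟨_, hDs k x hx, rfl⟩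
  have hnull : ρ (A \ ⋃ k, D k) = 0 := by
    have hle : ρ A ≤ ρ (⋃ k, D k) := by
      refine ENNReal.le_of_forall_pos_le_add fun ε hε _ => ?_
      obtain ⟨k, hk⟩ := ENNReal.exists_inv_nat_lt (ENNReal.coe_pos.2 hε).ne'
      have hk' : (k + 1 : ENNReal)⁻¹ ≤ ε :=
        (ENNReal.inv_le_inv.2 le_self_add).trans hk.le
      calc ρ A ≤ ρ (D k) + (k + 1 : ENNReal)⁻¹ := tsub_le_iff_right.1 (hρ k)
        _ ≤ ρ (⋃ k, D k) + ε := add_le_add (measure_mono (subset_iUnion D k)) hk'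
    rw [measure_sdiff hDA (MeasurableSet.iUnion hD).nullMeasurableSet (measure_ne_top _ _)]
    exact tsub_eq_zero_of_le hle
  classical
  have hfind : ∀ x, ∃ k, x ∈ D k ∨ x ∉ ⋃ k, D k := by
    intro x
    by_cases hx : x ∈ ⋃ k, D k
    · exact (mem_iUnion.1 hx).imp fun _ => .inl
    · exact ⟨0, .inr hx⟩
  refine ⟨fun x => s (Nat.find (hfind x)) x,
    Measurable.find (p := fun k x => x ∈ D k ∨ x ∉ ⋃ k, D k) hs
      (fun k => (hD k).union (MeasurableSet.iUnion hD).compl) hfind, ?_⟩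
  filter_upwards [measure_eq_zero_iff_ae_notMem.1 hnull] with x hx ⟨u, hu⟩
  have hxD : x ∈ ⋃ k, D k := by_contra fun h => hx ⟨⟨_, hu, rfl⟩, h⟩
  exact hDs _ _ ((Nat.find_spec (hfind x)).resolve_right (not_not.2 hxD))

/-! ### Trajectories and expected payoffs -/

namespace ReachAvoid.System

variable {n m : ℕ} (S : System n m)

theorem traj_succ_eq_next {t : ℕ} (ν : Fin t → S.X → S.U) (w : Fin t → S.W) (x : S.X)
    (k : Fin t) : S.traj ν w x k.succ =
      S.next (S.traj ν w x k.castSucc) (ν k (S.traj ν w x k.castSucc)) (w k) :=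
  rfl

/-- Restarting after one step: the states from time `1` on form the trajectory of the remaining
feedback laws from the successor state. -/
theorem traj_succ {t : ℕ} (ν : Fin (t + 1) → S.X → S.U) (w : Fin (t + 1) → S.W) (x : S.X)
    (k : Fin (t + 1)) : S.traj ν w x k.succ =
      S.traj (Fin.tail ν) (Fin.tail w) (S.next x (ν 0 x) (w 0)) k := by
  induction k using Fin.induction with
  | zero => rfl
  | succ k ih =>
    rw [traj_succ_eq_next, traj_succ_eq_next, ← ih]
    rfl

theorem measurable_next (hf : Measurable fun p : S.X × S.U => S.f p.1 p.2) :
    Measurable fun p : (S.X × S.U) × S.W => S.next p.1.1 p.1.2 p.2 :=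
  ((measurable_subtype_coe.comp (hf.comp measurable_fst)).add
    (measurable_subtype_coe.comp measurable_snd)).subtype_mk

theorem measurable_traj (hf : Measurable fun p : S.X × S.U => S.f p.1 p.2) {t : ℕ}
    {ν : Fin t → S.X → S.U} (hν : ∀ k, Measurable (ν k)) (k : Fin (t + 1)) :
    Measurable fun p : (Fin t → S.W) × S.X => S.traj ν p.1 p.2 k := by
  induction k using Fin.induction with
  | zero => exact measurable_snd
  | succ k ih =>
    exact (S.measurable_next hf).comp ((ih.prodMk ((hν k).comp ih)).prodMk
      ((measurable_pi_apply k).comp measurable_fst))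

/-- The reach-avoid payoff `(∏_{k<t} 1_K(x_k)) 1_T(x_t)` along a trajectory. -/
noncomputable def payoff (T K : Set S.X) {t : ℕ} (ν : Fin t → S.X → S.U) (w : Fin t → S.W)
    (x : S.X) : ENNReal :=
  (∏ k : Fin t, K.indicator (fun _ => (1 : ENNReal)) (S.traj ν w x k.castSucc)) *
    T.indicator (fun _ => (1 : ENNReal)) (S.traj ν w x (Fin.last t))

theorem payoff_cons (T K : Set S.X) {t : ℕ} (μ : S.X → S.U) (ν : Fin t → S.X → S.U)
    (w : Fin (t + 1) → S.W) (x : S.X) :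
    S.payoff T K (Fin.cons μ ν : Fin (t + 1) → S.X → S.U) w x =
      K.indicator (fun _ => (1 : ENNReal)) x *
        S.payoff T K ν (Fin.tail w) (S.next x (μ x) (w 0)) := by
  rw [payoff, payoff, Fin.prod_univ_succ, ← Fin.succ_last, traj_succ, mul_assoc]
  simp only [← Fin.succ_castSucc, traj_succ]
  rfl

theorem measurable_payoff (hf : Measurable fun p : S.X × S.U => S.f p.1 p.2) {T K : Set S.X}
    (hT : MeasurableSet T) (hK : MeasurableSet K) {t : ℕ}
    {ν : Fin t → S.X → S.U} (hν : ∀ k, Measurable (ν k)) :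
    Measurable fun p : (Fin t → S.W) × S.X => S.payoff T K ν p.1 p.2 :=
  (Finset.measurable_prod _ fun k _ => (measurable_const.indicator hK).comp
    (S.measurable_traj hf hν k.castSucc)).mul
    ((measurable_const.indicator hT).comp (S.measurable_traj hf hν (Fin.last t)))

/-- The expected payoff of arbitrary feedback laws, as a lower integral if the payoff is
not measurable in the disturbances. -/
noncomputable def expectedPayoff (Pw : Measure S.W) (T K : Set S.X) {t : ℕ}
    (ν : Fin t → S.X → S.U) (x : S.X) : ENNReal :=
  ∫⁻ w : Fin t → S.W, S.payoff T K ν w x ∂(Measure.pi fun _ : Fin t => Pw)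

theorem measurable_expectedPayoff (hf : Measurable fun p : S.X × S.U => S.f p.1 p.2)
    (Pw : Measure S.W) [SigmaFinite Pw] {T K : Set S.X}
    (hT : MeasurableSet T) (hK : MeasurableSet K) {t : ℕ}
    {ν : Fin t → S.X → S.U} (hν : ∀ k, Measurable (ν k)) :
    Measurable (S.expectedPayoff Pw T K ν) :=
  (S.measurable_payoff hf hT hK hν).lintegral_prod_left'

/-- The dynamic programming recursion for a fixed policy. Only the laws after the first have to be
Borel, since the first is evaluated at `x` alone. -/
theorem expectedPayoff_cons (hf : Measurable fun p : S.X × S.U => S.f p.1 p.2)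
    (Pw : Measure S.W) [SigmaFinite Pw] {T K : Set S.X}
    (hT : MeasurableSet T) (hK : MeasurableSet K) {t : ℕ} {μ : S.X → S.U}
    {ν : Fin t → S.X → S.U} (hν : ∀ k, Measurable (ν k)) (x : S.X) :
    S.expectedPayoff Pw T K (Fin.cons μ ν : Fin (t + 1) → S.X → S.U) x =
      K.indicator (fun _ => (1 : ENNReal)) x *
        ∫⁻ w, S.expectedPayoff Pw T K ν (S.next x (μ x) w) ∂Pw := by
  have hnext : Measurable fun w : S.W => S.next x (μ x) w :=
    (S.measurable_next hf).comp (measurable_prodMk_left (x := (x, μ x)))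
  have hg : Measurable fun p : S.W × (Fin t → S.W) => (p.2, S.next x (μ x) p.1) :=
    measurable_snd.prodMk (hnext.comp measurable_fst)
  have hm := Measurable.comp (S.measurable_payoff hf hT hK hν) hg
  dsimp only [Function.comp_def] at hm
  have hmp : MeasurePreserving (fun w : Fin (t + 1) → S.W => (w 0, Fin.tail w))
      (Measure.pi fun _ => Pw) (Pw.prod (Measure.pi fun _ => Pw)) :=
    measurePreserving_piFinSuccAbove (fun _ : Fin (t + 1) => Pw) 0
  have hK1 : K.indicator (fun _ => (1 : ENNReal)) x ≠ ⊤ := by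
    by_cases hx : x ∈ K <;> simp [hx]
  simp only [expectedPayoff, payoff_cons]
  rw [lintegral_const_mul' _ _ hK1, hmp.lintegral_comp hm, lintegral_prod _ hm.aemeasurable]

theorem expectedPayoff_le_optimalValue (Pw : Measure S.W) (T K : Set S.X) {N k t : ℕ}
    (ht : N - k = t) {ν : Fin t → S.X → S.U} (hν : ∀ k, Measurable (ν k)) (x : S.X) :
    S.expectedPayoff Pw T K ν x ≤ S.optimalValue Pw T K N k x := by
  subst ht
  exact le_iSup (fun π : S.MarkovPolicy (N - k) => S.reachAvoidProb Pw T K π x)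
    ⟨ν, fun k ρ _ => (hν k).nullMeasurable⟩

/-! ### Backward induction -/

theorem mem_of_mem_robustReachAvoid_succ {t : ℕ} {T K : Set S.X} {Wbar : Set S.W} {x : S.X}
    (hW : Wbar.Nonempty) (hx : x ∈ S.robustReachAvoid (t + 1) T K Wbar) : x ∈ K := by
  obtain ⟨ν, hν⟩ := hx
  obtain ⟨w, hw⟩ := hW
  exact (hν (fun _ => w) fun _ => hw).1 0

theorem exists_forall_next_mem_robustReachAvoid {t : ℕ} {T K : Set S.X} {Wbar : Set S.W}
    {x : S.X} (hx : x ∈ S.robustReachAvoid (t + 1) T K Wbar) :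
    ∃ u : S.U, ∀ w ∈ Wbar, S.next x u w ∈ S.robustReachAvoid t T K Wbar := by
  obtain ⟨ν, hν⟩ := hx
  refine ⟨ν 0 x, fun w₀ hw₀ => ⟨Fin.tail ν, fun w hw => ?_⟩⟩
  obtain ⟨h₁, h₂⟩ := hν (Fin.cons w₀ w : Fin (t + 1) → S.W) (Fin.cases hw₀ hw)
  rw [← Fin.succ_last, traj_succ] at h₂
  refine ⟨fun k => ?_, h₂⟩
  have := h₁ k.succ
  rwa [← Fin.succ_castSucc, traj_succ] at this

theorem expectedPayoff_zero_eq_one {Pw : Measure S.W} [SigmaFinite Pw] {T K : Set S.X}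
    {Wbar : Set S.W} {x : S.X} (hx : x ∈ S.robustReachAvoid 0 T K Wbar)
    {ν : Fin 0 → S.X → S.U} : S.expectedPayoff Pw T K ν x = 1 := by
  obtain ⟨ν', hν'⟩ := hx
  have hxT : x ∈ T := (hν' Fin.elim0 fun k => k.elim0).2
  have h : ∀ w, S.payoff T K ν w x = 1 := fun w => by
    simp [payoff, traj, hxT]
  simp [expectedPayoff, h]

/-- Since the disturbance has a density, a Lebesgue-null set of states is almost surely not hit
in one step, whatever the state and the input are. -/
theorem ae_next (hX : MeasurableSet S.X) {Pw : Measure S.W}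
    (hac : Pw.map (fun w : S.W => (w : EuclideanSpace ℝ (Fin n))) ≪ volume)
    {p : S.X → Prop} (hp : ∀ᵐ x ∂(volume.comap Subtype.val : Measure S.X), p x)
    (x : S.X) (u : S.U) : ∀ᵐ w ∂Pw, p (S.next x u w) := by
  rw [ae_iff, (MeasurableEmbedding.subtype_coe hX).comap_apply] at hp
  have h : ∀ᵐ z : EuclideanSpace ℝ (Fin n),
      (S.f x u : EuclideanSpace ℝ (Fin n)) + z ∉ Subtype.val '' {y : S.X | ¬ p y} := by
    exact measure_eq_zero_iff_ae_notMem.1 ((measure_preimage_add volume _ _).trans hp)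
  filter_upwards [ae_of_ae_map measurable_subtype_coe.aemeasurable (hac.ae_le h)] with w hw
  by_contra hne
  exact hw ⟨S.next x u w, hne, rfl⟩

/-- One step of the backward induction: if a policy for `t` stages succeeds with probability at
least `c` from almost every state of the robust set, then from every state of the robust set for
`t + 1` stages some input leads to success with probability at least `Pw Wbar * c`. -/
theorem exists_le_lintegral_next (hX : MeasurableSet S.X) {Pw : Measure S.W}
    (hac : Pw.map (fun w : S.W => (w : EuclideanSpace ℝ (Fin n))) ≪ volume)
    {T K : Set S.X} {Wbar : Set S.W} (hWbar : MeasurableSet Wbar) {t : ℕ} {c : ENNReal}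
    {J : S.X → ENNReal}
    (hJ : ∀ᵐ x ∂(volume.comap Subtype.val : Measure S.X),
      x ∈ S.robustReachAvoid t T K Wbar → c ≤ J x)
    {x : S.X} (hx : x ∈ S.robustReachAvoid (t + 1) T K Wbar) :
    ∃ u : S.U, Pw Wbar * c ≤ K.indicator (fun _ => (1 : ENNReal)) x *
      ∫⁻ w, J (S.next x u w) ∂Pw := by
  obtain ⟨u, hu⟩ := S.exists_forall_next_mem_robustReachAvoid hx
  refine ⟨u, ?_⟩
  -- For an empty `Wbar` robust membership does not force `x ∈ K`, but then the bound is `0`.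
  obtain rfl | hW := Wbar.eq_empty_or_nonempty
  · simp
  rw [Set.indicator_of_mem (S.mem_of_mem_robustReachAvoid_succ hW hx), one_mul, mul_comm,
    ← lintegral_indicator_const hWbar]
  refine lintegral_mono_ae ?_
  filter_upwards [S.ae_next hX hac hJ x u] with w hw
  by_cases h : w ∈ Wbar
  · simpa [h] using hw (hu w h)
  · simp [h]

/-- Borel policies are good enough almost everywhere: measurable selection in each stage turns the
arbitrary robust feedback laws into Borel ones, at the price of a Lebesgue-null set of states. -/
theorem exists_measurable_policy_ae (hX : MeasurableSet S.X) (hU : IsCompact S.U) [Nonempty S.U]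
    (hf : Measurable fun p : S.X × S.U => S.f p.1 p.2) {Pw : Measure S.W} [SigmaFinite Pw]
    (hac : Pw.map (fun w : S.W => (w : EuclideanSpace ℝ (Fin n))) ≪ volume)
    {T K : Set S.X} (hT : MeasurableSet T) (hK : MeasurableSet K)
    {Wbar : Set S.W} (hWbar : MeasurableSet Wbar) (t : ℕ) :
    ∃ ν : Fin t → S.X → S.U, (∀ k, Measurable (ν k)) ∧
      ∀ᵐ x ∂(volume.comap Subtype.val : Measure S.X),
        x ∈ S.robustReachAvoid t T K Wbar → Pw Wbar ^ t ≤ S.expectedPayoff Pw T K ν x := by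
  induction t with
  | zero =>
    refine ⟨Fin.elim0, fun k => k.elim0, .of_forall fun x hx => ?_⟩
    rw [pow_zero, S.expectedPayoff_zero_eq_one hx]
  | succ t ih =>
    obtain ⟨ν, hν, hae⟩ := ih
    have := hX.standardBorel
    have := hU.isClosed.measurableSet.standardBorel
    have hσ : SigmaFinite (volume.comap Subtype.val : Measure S.X) :=
      .of_map _ measurable_subtype_coe.aemeasurable (by
        rw [map_comap_subtype_coe hX]
        infer_instance)
    have hint : Measurable fun p : S.X × S.U => K.indicator (fun _ => (1 : ENNReal)) p.1 *
        ∫⁻ w, S.expectedPayoff Pw T K ν (S.next p.1 p.2 w) ∂Pw :=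
      ((measurable_const.indicator hK).comp measurable_fst).mul
        ((S.measurable_expectedPayoff hf Pw hT hK hν).comp
          (S.measurable_next hf)).lintegral_prod_right'
    obtain ⟨μ, hμ, hsel⟩ := (measurableSet_le (measurable_const (a := Pw Wbar * Pw Wbar ^ t))
      hint).exists_measurable_selection (volume.comap Subtype.val : Measure S.X).toFinite
    have hcons : ∀ k, Measurable ((Fin.cons μ ν : Fin (t + 1) → S.X → S.U) k) :=
      Fin.cases hμ hν
    refine ⟨Fin.cons μ ν, hcons, ?_⟩
    rw [ae_toFinite] at hsel
    filter_upwards [hsel] with x hx hxt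
    rw [S.expectedPayoff_cons hf Pw hT hK hν, pow_succ']
    exact hx (S.exists_le_lintegral_next hX hac hWbar hae hxt)

/-- From a single initial state the exceptional null set disappears: the first law may be taken
constant, and the disturbance almost surely avoids the null set of the later ones. -/
theorem exists_measurable_policy (hX : MeasurableSet S.X) (hU : IsCompact S.U)
    (hf : Measurable fun p : S.X × S.U => S.f p.1 p.2) {Pw : Measure S.W} [SigmaFinite Pw]
    (hac : Pw.map (fun w : S.W => (w : EuclideanSpace ℝ (Fin n))) ≪ volume)
    {T K : Set S.X} (hT : MeasurableSet T) (hK : MeasurableSet K)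
    {Wbar : Set S.W} (hWbar : MeasurableSet Wbar) {t : ℕ} {x : S.X}
    (hx : x ∈ S.robustReachAvoid t T K Wbar) :
    ∃ ν : Fin t → S.X → S.U, (∀ k, Measurable (ν k)) ∧
      Pw Wbar ^ t ≤ S.expectedPayoff Pw T K ν x := by
  cases t with
  | zero =>
    exact ⟨Fin.elim0, fun k => k.elim0, by rw [pow_zero, S.expectedPayoff_zero_eq_one hx]⟩
  | succ t =>
    have : Nonempty S.U := ⟨hx.choose 0 x⟩
    obtain ⟨ν, hν, hae⟩ := S.exists_measurable_policy_ae hX hU hf hac hT hK hWbar t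
    obtain ⟨u, hu⟩ := S.exists_le_lintegral_next hX hac hWbar hae hx
    have hcons : ∀ k, Measurable ((Fin.cons (fun _ => u) ν : Fin (t + 1) → S.X → S.U) k) :=
      Fin.cases measurable_const hν
    refine ⟨Fin.cons (fun _ => u) ν, hcons, ?_⟩
    rw [S.expectedPayoff_cons hf Pw hT hK hν, pow_succ']
    exact hu

end ReachAvoid.System

theorem mainTheorem1 {n m : ℕ} (S : ReachAvoid.System n m)
    (hX : MeasurableSet S.X)
    (hf : Measurable (fun p : S.X × S.U => S.f p.1 p.2))
    (hU : IsCompact S.U)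
    (Pw : MeasureTheory.Measure S.W) (hPw : MeasureTheory.IsProbabilityMeasure Pw)
    (ψ : EuclideanSpace ℝ (Fin n) → ℝ) (hψ0 : ∀ y, 0 ≤ ψ y) (hψm : Measurable ψ)
    (hψc : ContinuousOn ψ S.W)
    (hψ : Pw.map (fun w : S.W => (w : EuclideanSpace ℝ (Fin n))) =
      MeasureTheory.volume.withDensity (fun y => ENNReal.ofReal (ψ y)))
    (T K : Set S.X) (hT : IsClosed T) (hK : IsClosed K)
    (N : ℕ) (β : ℝ) (hβ : β ∈ Set.Icc (0 : ℝ) 1)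
    (t : ℕ) (htN : t ≤ N)
    (Wbar : Set S.W) (hWbar : MeasurableSet Wbar)
    (hprob : 0 < t → Pw.real Wbar = β ^ (1 / (t : ℝ))) :
    S.robustReachAvoid t T K Wbar ⊆ S.levelSet Pw T K N t β := by
  intro x hx
  have hac : Pw.map (fun w : S.W => (w : EuclideanSpace ℝ (Fin n))) ≪ MeasureTheory.volume :=
    hψ ▸ MeasureTheory.withDensity_absolutelyContinuous _ _
  obtain ⟨ν, hν, hle⟩ := S.exists_measurable_policy hX hU hf hac hT.measurableSet
    hK.measurableSet hWbar hx
  have hβt : ENNReal.ofReal β ≤ Pw Wbar ^ t := by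
    obtain rfl | ht := t.eq_zero_or_pos
    · simpa using hβ.2
    · rw [← MeasureTheory.ofReal_measureReal (MeasureTheory.measure_ne_top _ _), hprob ht,
        ← ENNReal.ofReal_pow (Real.rpow_nonneg hβ.1 _), one_div,
        Real.rpow_inv_natCast_pow hβ.1 ht.ne']
  exact (hβt.trans hle).trans
    (S.expectedPayoff_le_optimalValue Pw T K (Nat.sub_sub_self htN) hν x)
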